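/- All spaces are Tychonoff. A set $C\subset X$ is regularly closed if $C=\overline{\operatorname{Int} C}$. Consider functions $\rho(x,C)\in[0,\infty)$ of a point $x\in X$ and a regularly closed set $C\subset X$, and the conditions - K1) $\rho(x,C)=0$ iff $x\in C$; - K1)$^*$ for every $C$ there is a dense open subset $V$ of $X\setminus C$ such that $\rho(x,C)>0$ iff $x\in V$; - K2) if $C\subset C'$ then $\rho(x,C')\le\rho(x,C)$ for all $x$; - K3) $\rho(\cdot,C)$ is continuous for every $C$; - K4) $\rho(x,\overline{\bigcup_\alpha C_\alpha})=\inf_\alpha\rho(x,C_\alpha)$ for all $x$ and every non-empty increasing transfinite (i.e. well-ordered) family $\{C_\alpha\}$ of regularly closed sets; - K5) $\rho(x,C)\le\rho(x,C')+\sup_{y\in C'}\rho(y,C)$ for all $x$ and all regularly closed $C,C'$ (supremum in $[0,\infty]$). The space $X$ is $\kappa$-metrizable if it admits a $\rho$ with K1)–K4), quasi $\kappa$-metrizable if it admits a $\rho$ with K1)$^*$, K2)–K4), and regularly quasi $\kappa$-metrizable if it admits a $\rho$ with K1)$^*$, K2)–K5). An absolute of $X$ is an extremally disconnected space $Z$ together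 with a perfect surjection $f:Z\to X$ that is irreducible, i.e. $f(F)\neq X$ for every proper closed subset $F$ of $Z$. **Corollary 3.7 (with Remark 3.8).** 1. Every space $X$ has an absolute. 2. If $X$ is quasi $\kappa$-metrizable (resp., regularly quasi $\kappa$-metrizable), then so is every absolute of $X$. 3. If $X$ is an infinite compact $\kappa$-metrizable space, then every absolute of $X$ is quasi $\kappa$-metrizable but not $\kappa$-metrizable. 4. Consequently, the $\kappa$-metrizable spaces form a proper subclass of the quasi $\kappa$-metrizable spaces: every $\kappa$-metrizable space is quasi $\kappa$-metrizable, and there is a quasi $\kappa$-metrizable space that is not $\kappa$-metrizable. -/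

import Mathlib

open Set Topology
open scoped NNReal ENNReal

universe u

/-- A regularly closed set: the closure of its interior (equivalently, of some open set). -/
def IsRegularlyClosed {X : Type u} [TopologicalSpace X] (C : Set X) : Prop :=
  closure (interior C) = C

/-- The axioms K2, K3, K4 for a non-negative function `ρ x C` of a point `x` and a regularly
closed set `C`. The values of `ρ` at sets that are not regularly closed are irrelevant. -/
structure KappaCore {X : Type u} [TopologicalSpace X] (ρ : X → Set X → ℝ≥0) : Prop where
  /-- K2: `ρ` is decreasing in the set. -/
  anti : ∀ C C' : Set X, IsRegularlyClosed C → IsRegularlyClosed C' → C ⊆ C' →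
    ∀ x, ρ x C' ≤ ρ x C
  /-- K3: `ρ` is continuous in the point. -/
  cont : ∀ C : Set X, IsRegularlyClosed C → Continuous fun x => ρ x C
  /-- K4: for increasing transfinite (that is, indexed by a non-empty well-ordered set) families
  of regularly closed sets, `ρ` at the closure of the union is the infimum. -/
  closure_iUnion : ∀ (ι : Type u) [LinearOrder ι] [WellFoundedLT ι] [Nonempty ι]
    (C : ι → Set X), (∀ i, IsRegularlyClosed (C i)) → Monotone C →
    ∀ x, ρ x (closure (⋃ i, C i)) = ⨅ i, ρ x (C i)

/-- A `κ`-metric: K1 (`ρ x C = 0` iff `x ∈ C`) and K2, K3, K4. -/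
structure IsKappaMetric {X : Type u} [TopologicalSpace X] (ρ : X → Set X → ℝ≥0) : Prop
    extends KappaCore ρ where
  eq_zero_iff : ∀ C : Set X, IsRegularlyClosed C → ∀ x, ρ x C = 0 ↔ x ∈ C

/-- A quasi `κ`-metric: K2, K3, K4, and for each regularly closed `C` there is a dense open
subset `V` of the complement of `C` such that `ρ x C > 0` iff `x ∈ V`. -/
structure IsQuasiKappaMetric {X : Type u} [TopologicalSpace X] (ρ : X → Set X → ℝ≥0) : Prop
    extends KappaCore ρ where
  exists_dense : ∀ C : Set X, IsRegularlyClosed C →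
    ∃ V : Set X, IsOpen V ∧ V ⊆ Cᶜ ∧ Cᶜ ⊆ closure V ∧ ∀ x, 0 < ρ x C ↔ x ∈ V

/-- K5, regularity. The supremum is taken in `[0, ∞]`. -/
def IsRegularKappa {X : Type u} [TopologicalSpace X] (ρ : X → Set X → ℝ≥0) : Prop :=
  ∀ C C' : Set X, IsRegularlyClosed C → IsRegularlyClosed C' → ∀ x,
    (ρ x C : ℝ≥0∞) ≤ (ρ x C' : ℝ≥0∞) + ⨆ y ∈ C', (ρ y C : ℝ≥0∞)

def KappaMetrizable (X : Type u) [TopologicalSpace X] : Prop :=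
  ∃ ρ : X → Set X → ℝ≥0, IsKappaMetric ρ

def QuasiKappaMetrizable (X : Type u) [TopologicalSpace X] : Prop :=
  ∃ ρ : X → Set X → ℝ≥0, IsQuasiKappaMetric ρ

def RegularlyQuasiKappaMetrizable (X : Type u) [TopologicalSpace X] : Prop :=
  ∃ ρ : X → Set X → ℝ≥0, IsQuasiKappaMetric ρ ∧ IsRegularKappa ρ

/-- `Z` together with `f : Z → X` is an absolute of `X`: `Z` is an extremally disconnected
Tychonoff space and `f` is a perfect irreducible surjection. (`IsProperMap` means continuous,
closed, with compact fibres.) -/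
structure IsAbsolute {Z X : Type u} [TopologicalSpace Z] [TopologicalSpace X] (f : Z → X) :
    Prop where
  tychonoff : T35Space Z
  extremallyDisconnected : ExtremallyDisconnected Z
  perfect : IsProperMap f
  surjective : Function.Surjective f
  irreducible : ∀ F : Set Z, IsClosed F → f '' F = univ → F = univ

/-!
If `f : Z → X` is closed, continuous and irreducible, a quasi `κ`-metric `ρ` on `X` pulls back to
`ρ (f z) (f '' C)`: images of regularly closed sets are regularly closed, and K1* survives because
irreducibility makes preimages of dense sets dense. K1 does not survive, since `f ⁻¹' (f '' C)` may
be larger than `C`. An absolute of a compactum is a minimal closed subset, mapping onto it, of an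
extremally disconnected compactum; a Tychonoff space gets its absolute from one of its Stone–Čech
compactification, restricted to a preimage.

In an extremally disconnected `κ`-metrizable space every disjoint sequence of open sets is locally
finite. Otherwise it accumulates at a point `x`, and K4 lets us group its members into consecutive
finite blocks whose closures have `ρ`-distance from `x` tending to `0`. Then the union of the even
blocks and that of the odd blocks both have `x` in their closure, although disjoint open sets have
disjoint closures.
-/

open scoped Function

section RegularlyClosed

variable {X : Type*} [TopologicalSpace X]

theorem IsRegularlyClosed.closure_interior_eq {C : Set X} (hC : IsRegularlyClosed C) :
    closure (interior C) = C := hC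

theorem IsRegularlyClosed.isClosed {C : Set X} (hC : IsRegularlyClosed C) : IsClosed C :=
  hC.closure_interior_eq ▸ isClosed_closure

theorem isRegularlyClosed_closure {U : Set X} (hU : IsOpen U) : IsRegularlyClosed (closure U) :=
  (closure_minimal interior_subset isClosed_closure).antisymm
    (closure_mono hU.subset_interior_closure)

theorem isRegularlyClosed_closure_iUnion {ι : Sort*} {C : ι → Set X}
    (hC : ∀ i, IsRegularlyClosed (C i)) : IsRegularlyClosed (closure (⋃ i, C i)) := by
  have hdense : closure (⋃ i, C i) = closure (⋃ i, interior (C i)) := by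
    refine (closure_minimal (iUnion_subset fun i => ?_) isClosed_closure).antisymm
      (closure_mono (iUnion_mono fun i => interior_subset))
    calc C i = closure (interior (C i)) := (hC i).closure_interior_eq.symm
      _ ⊆ closure (⋃ i, interior (C i)) := closure_mono (subset_iUnion_of_subset i Subset.rfl)
  rw [hdense]
  exact isRegularlyClosed_closure (isOpen_iUnion fun i => isOpen_interior)

end RegularlyClosed

section Irreducible

/-- An irreducible map: a surjection that maps no proper closed subset onto the whole codomain.
Continuity and closedness are not part of the definition. -/
structure IsIrreducibleMap {Z X : Type*} [TopologicalSpace Z] (f : Z → X) : Prop where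
  surjective : Function.Surjective f
  eq_univ_of_image_eq_univ : ∀ F : Set Z, IsClosed F → f '' F = univ → F = univ

namespace IsIrreducibleMap

variable {Z X : Type*} [TopologicalSpace Z] {f : Z → X}

theorem kernImage_nonempty (hf : IsIrreducibleMap f) {U : Set Z} (hU : IsOpen U)
    (hne : U.Nonempty) : (kernImage f U).Nonempty := by
  rw [kernImage_eq_compl, nonempty_compl]
  exact fun h => compl_ne_univ.2 hne (hf.eq_univ_of_image_eq_univ _ hU.isClosed_compl h)

theorem eq_self_of_comp_eq [T2Space Z] (hf : IsIrreducibleMap f) {g : Z → Z} (hg : Continuous g)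
    (hfg : f ∘ g = f) (z : Z) : g z = z := by
  by_contra hne
  obtain ⟨V, U, hV, hU, hzV, hzU, hVU⟩ := t2_separation hne
  obtain ⟨x, hx⟩ := hf.kernImage_nonempty (hU.inter (hV.preimage hg)) ⟨z, hzU, hzV⟩
  obtain ⟨y, rfl⟩ := hf.surjective x
  -- `y` and `g y` lie over the same point, whose whole fibre is in `U`; but `g y ∈ V`.
  exact disjoint_left.1 hVU (hx rfl).2 (hx (congrFun hfg y)).1

variable [TopologicalSpace X]

theorem subset_closure_preimage (hf : IsIrreducibleMap f) (hcl : IsClosedMap f) {U : Set Z}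
    (hU : IsOpen U) {D : Set X} (hD : kernImage f U ⊆ closure D) : U ⊆ closure (f ⁻¹' D) := by
  intro z hz
  rw [mem_closure_iff]
  intro N hN hzN
  have hopen : IsOpen (kernImage f (N ∩ U)) := isClosedMap_iff_kernImage.1 hcl (hN.inter hU)
  obtain ⟨x, hx⟩ := hf.kernImage_nonempty (hN.inter hU) ⟨z, hzN, hz⟩
  obtain ⟨d, hd, hdD⟩ := mem_closure_iff.1 (hD (kernImage_mono inter_subset_right hx)) _ hopen hx
  obtain ⟨y, rfl⟩ := hf.surjective d
  exact ⟨y, (hd rfl).1, hdD⟩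

theorem dense_preimage (hf : IsIrreducibleMap f) (hcl : IsClosedMap f) {D : Set X}
    (hD : Dense D) : Dense (f ⁻¹' D) := fun z =>
  hf.subset_closure_preimage hcl isOpen_univ (fun x _ => hD x) (mem_univ z)

theorem image_closure_eq_closure_kernImage (hf : IsIrreducibleMap f) (hcl : IsClosedMap f)
    (hc : Continuous f) {U : Set Z} (hU : IsOpen U) :
    f '' closure U = closure (kernImage f U) := by
  apply Subset.antisymm
  · have hU_sub : U ⊆ closure (f ⁻¹' kernImage f U) :=
      hf.subset_closure_preimage hcl hU subset_closure
    exact image_subset_iff.2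
      ((closure_minimal hU_sub isClosed_closure).trans (hc.closure_preimage_subset _))
  · refine closure_minimal (fun x hx => ?_) (hcl _ isClosed_closure)
    obtain ⟨z, rfl⟩ := hf.surjective x
    exact mem_image_of_mem f (subset_closure (hx rfl))

theorem isRegularlyClosed_image (hf : IsIrreducibleMap f) (hcl : IsClosedMap f)
    (hc : Continuous f) {C : Set Z} (hC : IsRegularlyClosed C) : IsRegularlyClosed (f '' C) := by
  rw [← hC.closure_interior_eq,
    hf.image_closure_eq_closure_kernImage hcl hc isOpen_interior]
  exact isRegularlyClosed_closure (isClosedMap_iff_kernImage.1 hcl isOpen_interior)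

theorem restrictPreimage (hf : IsIrreducibleMap f) (hcl : IsClosedMap f) {S : Set X}
    (hS : Dense S) : IsIrreducibleMap (S.restrictPreimage f) where
  surjective := hf.surjective.restrictPreimage S
  eq_univ_of_image_eq_univ F hF hFS := by
    have hsub : S ⊆ f '' closure (Subtype.val '' F) := by
      intro x hx
      obtain ⟨z, hz, hzx⟩ := hFS.ge (mem_univ (⟨x, hx⟩ : S))
      exact ⟨z, subset_closure (mem_image_of_mem _ hz), congrArg Subtype.val hzx⟩
    have hdense : closure (Subtype.val '' F) = univ :=
      hf.eq_univ_of_image_eq_univ _ isClosed_closure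
        ((hcl _ isClosed_closure).closure_eq ▸ (hS.mono hsub).closure_eq)
    rw [← hF.closure_eq, IsInducing.subtypeVal.closure_eq_preimage_closure_image, hdense,
      preimage_univ]

end IsIrreducibleMap

end Irreducible

section Pullback

variable {Z X : Type u} [TopologicalSpace Z] [TopologicalSpace X] {f : Z → X}
  {ρ : X → Set X → ℝ≥0}

theorem KappaCore.comap (hρ : KappaCore ρ) (hf : IsIrreducibleMap f) (hcl : IsClosedMap f)
    (hc : Continuous f) : KappaCore fun z C => ρ (f z) (f '' C) where
  anti C C' hC hC' hCC' z :=
    hρ.anti _ _ (hf.isRegularlyClosed_image hcl hc hC) (hf.isRegularlyClosed_image hcl hc hC')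
      (image_mono hCC') (f z)
  cont C hC := (hρ.cont _ (hf.isRegularlyClosed_image hcl hc hC)).comp hc
  closure_iUnion ι _ _ _ C hC hmono z := by
    rw [← hcl.closure_image_eq_of_continuous hc, image_iUnion]
    exact hρ.closure_iUnion ι _ (fun i => hf.isRegularlyClosed_image hcl hc (hC i))
      (fun i j hij => image_mono (hmono hij)) (f z)

theorem IsQuasiKappaMetric.comap (hρ : IsQuasiKappaMetric ρ) (hf : IsIrreducibleMap f)
    (hcl : IsClosedMap f) (hc : Continuous f) :
    IsQuasiKappaMetric fun z C => ρ (f z) (f '' C) where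
  toKappaCore := hρ.toKappaCore.comap hf hcl hc
  exists_dense C hC := by
    obtain ⟨V, hV, hVC, hCV, hpos⟩ := hρ.exists_dense _ (hf.isRegularlyClosed_image hcl hc hC)
    refine ⟨f ⁻¹' V, hV.preimage hc, fun z hz hzC => hVC hz (mem_image_of_mem f hzC),
      hf.subset_closure_preimage hcl hC.isClosed.isOpen_compl ?_, fun z => hpos (f z)⟩
    rwa [kernImage_compl]

theorem IsRegularKappa.comap (hρ : IsRegularKappa ρ) (hf : IsIrreducibleMap f)
    (hcl : IsClosedMap f) (hc : Continuous f) :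
    IsRegularKappa fun z C => ρ (f z) (f '' C) := fun C C' hC hC' z => by
  have h := hρ _ _ (hf.isRegularlyClosed_image hcl hc hC)
    (hf.isRegularlyClosed_image hcl hc hC') (f z)
  rwa [iSup_image] at h

end Pullback

section ExtremallyDisconnected

theorem extremallyDisconnected_of_isDenseInducing {S Z : Type*} [TopologicalSpace S]
    [TopologicalSpace Z] [ExtremallyDisconnected Z] {j : S → Z} (hj : IsDenseInducing j) :
    ExtremallyDisconnected S where
  open_closure U hU := by
    obtain ⟨V, hV, rfl⟩ := hj.isInducing.isOpen_iff.1 hU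
    have hVj : closure (V ∩ range j) = closure V :=
      (closure_mono inter_subset_left).antisymm
        (closure_minimal (hj.dense.open_subset_closure_inter hV) isClosed_closure)
    rw [hj.isInducing.closure_eq_preimage_closure_image, image_preimage_eq_inter_range, hVj]
    exact (ExtremallyDisconnected.open_closure V hV).preimage hj.continuous

theorem projective_of_leftInverse {D E : Type u} [TopologicalSpace D] [TopologicalSpace E]
    (hD : CompactT2.Projective D) {i : E → D} {r : D → E} (hi : Continuous i)
    (hr : Continuous r) (hri : Function.LeftInverse r i) : CompactT2.Projective E := by
  intro Y Z _ _ _ _ _ _ φ g hφ hg hgs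
  obtain ⟨h, hh, hgh⟩ := hD (hφ.comp hr) hg hgs
  exact ⟨h ∘ i, hh.comp hi, by
    rw [← Function.comp_assoc, hgh, Function.comp_assoc, hri.comp_eq_id, Function.comp_id]⟩

end ExtremallyDisconnected

namespace IsAbsolute

variable {Z X : Type u} [TopologicalSpace Z] [TopologicalSpace X] {f : Z → X}

theorem isIrreducibleMap (hf : IsAbsolute f) : IsIrreducibleMap f :=
  ⟨hf.surjective, hf.irreducible⟩

theorem restrictPreimage (hf : IsAbsolute f) {S : Set X} (hS : Dense S) :
    IsAbsolute (S.restrictPreimage f) := by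
  have := hf.tychonoff
  have := hf.extremallyDisconnected
  have hirr := hf.isIrreducibleMap.restrictPreimage hf.perfect.isClosedMap hS
  have hdense : Dense (f ⁻¹' S) := hf.isIrreducibleMap.dense_preimage hf.perfect.isClosedMap hS
  exact
    { tychonoff := inferInstance
      extremallyDisconnected :=
        extremallyDisconnected_of_isDenseInducing ⟨.subtypeVal, hdense.denseRange_val⟩
      perfect := hf.perfect.restrictPreimage S
      surjective := hirr.surjective
      irreducible := hirr.eq_univ_of_image_eq_univ }

theorem homeomorph_comp {Y : Type u} [TopologicalSpace Y] (hf : IsAbsolute f) (e : X ≃ₜ Y) :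
    IsAbsolute (e ∘ f) where
  tychonoff := hf.tychonoff
  extremallyDisconnected := hf.extremallyDisconnected
  perfect := e.isProperMap.comp hf.perfect
  surjective := e.surjective.comp hf.surjective
  irreducible F hF h := hf.irreducible F hF <| e.injective.image_injective <| by
    rw [← image_comp, h, image_univ_of_surjective e.surjective]

end IsAbsolute

theorem exists_isAbsolute_of_compactSpace (K : Type u) [TopologicalSpace K] [CompactSpace K]
    [T2Space K] : ∃ (E : Type u) (_ : TopologicalSpace E) (p : E → K), IsAbsolute p := by
  let D := (CompHaus.of K).presentation
  obtain ⟨q, hq, hqs⟩ : ∃ q : D → K, Continuous q ∧ Function.Surjective q :=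
    ⟨CompHaus.presentation.π (CompHaus.of K), by fun_prop,
      (CompHaus.epi_iff_surjective _).1 inferInstance⟩
  have hD : CompactT2.Projective D := CompactT2.ExtremallyDisconnected.projective
  obtain ⟨E, hE, hqE, hEmin⟩ := exists_compact_surjective_zorn_subset hq hqs
  let p : E → K := E.domRestrict q
  have hp : Continuous p := hq.continuousOn.domRestrict
  have hirr : IsIrreducibleMap p :=
    { surjective := surjOn_iff_surjective.1 hqE.ge
      eq_univ_of_image_eq_univ := fun F hF h => by
        by_contra hne
        exact hEmin F hne hF h }
  -- A lift of `q` through `p` restricts to a self-map of `E` over `K`, hence to the identity.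
  obtain ⟨r, hr, hpr⟩ := hD hq hp hirr.surjective
  have hretract : Function.LeftInverse r Subtype.val :=
    hirr.eq_self_of_comp_eq (hr.comp continuous_subtype_val) (funext fun e => congrFun hpr e)
  have hE_proj : CompactT2.Projective E :=
    projective_of_leftInverse hD continuous_subtype_val hr hretract
  exact ⟨E, inferInstance, p, inferInstance, hE_proj.extremallyDisconnected, hp.isProperMap,
    hirr.surjective, hirr.eq_univ_of_image_eq_univ⟩

theorem exists_isAbsolute (X : Type u) [TopologicalSpace X] [T35Space X] :
    ∃ (Z : Type u) (_ : TopologicalSpace Z) (f : Z → X), IsAbsolute f := by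
  obtain ⟨E, _, p, hp⟩ := exists_isAbsolute_of_compactSpace (StoneCech X)
  let e : X ≃ₜ range (stoneCechUnit : X → StoneCech X) := isEmbedding_stoneCechUnit.toHomeomorph
  exact ⟨_, _, _, (hp.restrictPreimage denseRange_stoneCechUnit).homeomorph_comp e.symm⟩

section AccumulatingSequences

theorem exists_forall_mem_closure_of_not_locallyFinite {X : Type*} [TopologicalSpace X]
    {U : ℕ → Set X} (hU : ¬ LocallyFinite U) : ∃ x, ∀ m, x ∈ closure (⋃ n ≥ m, U n) := by
  contrapose! hU
  intro x
  obtain ⟨m, hm⟩ := hU x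
  refine ⟨(closure (⋃ n ≥ m, U n))ᶜ, isClosed_closure.isOpen_compl.mem_nhds hm,
    (finite_Iio m).subset ?_⟩
  rintro n ⟨y, hyn, hy⟩
  by_contra hmn
  exact hy (subset_closure (mem_iUnion₂.2 ⟨n, not_lt.1 hmn, hyn⟩))

theorem disjoint_biUnion_of_pairwise_disjoint {α ι : Type*} {U : ι → Set α}
    (hU : Pairwise (Disjoint on U)) {I J : Set ι} (hIJ : Disjoint I J) :
    Disjoint (⋃ i ∈ I, U i) (⋃ j ∈ J, U j) :=
  disjoint_iUnion₂_left.2 fun _ hi =>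
    disjoint_iUnion₂_right.2 fun _ hj => hU (hIJ.ne_of_mem hi hj)

variable {X : Type u} [TopologicalSpace X] {ρ : X → Set X → ℝ≥0}

theorem KappaCore.closure_iUnion_nat (hρ : KappaCore ρ) {C : ℕ → Set X}
    (hC : ∀ n, IsRegularlyClosed (C n)) (hmono : Monotone C) (x : X) :
    ρ x (closure (⋃ n, C n)) = ⨅ n, ρ x (C n) := by
  have h := hρ.closure_iUnion (ULift.{u} ℕ) (fun n => C n.down) (fun n => hC n.down)
    (fun _ _ hmn => hmono hmn) x
  rwa [ULift.down_surjective.iUnion_comp C, ULift.down_surjective.iInf_comp fun n => ρ x (C n)] at h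

namespace IsKappaMetric

theorem mem_of_forall_exists_lt (hρ : IsKappaMetric ρ) {C : Set X} (hC : IsRegularlyClosed C)
    {x : X} (h : ∀ ε > 0, ∃ B ⊆ C, IsRegularlyClosed B ∧ ρ x B < ε) : x ∈ C := by
  rw [← hρ.eq_zero_iff C hC]
  by_contra hne
  obtain ⟨B, hBC, hB, hlt⟩ := h _ (pos_iff_ne_zero.2 hne)
  exact (hρ.anti B C hB hC hBC x).not_gt hlt

variable {U : ℕ → Set X} {x : X}

theorem exists_lt_closure_biUnion_Ico (hρ : IsKappaMetric ρ) (hU : ∀ n, IsOpen (U n)) {m : ℕ}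
    (hx : x ∈ closure (⋃ n ≥ m, U n)) {ε : ℝ≥0} (hε : 0 < ε) :
    ∃ n > m, ρ x (closure (⋃ i ∈ Ico m n, U i)) < ε := by
  let C (n : ℕ) : Set X := closure (⋃ i ∈ Ico m n, U i)
  have hC (n : ℕ) : IsRegularlyClosed (C n) :=
    isRegularlyClosed_closure (isOpen_biUnion fun i _ => hU i)
  have hmono : Monotone C := fun n n' hn =>
    closure_mono (biUnion_subset_biUnion_left (Ico_subset_Ico_right hn))
  have hxC : x ∈ closure (⋃ n, C n) := by
    refine closure_mono (iUnion₂_subset fun i hi => ?_) hx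
    calc U i ⊆ C (i + 1) :=
          (subset_biUnion_of_mem (u := U) (mem_Ico.2 ⟨hi, i.lt_succ_self⟩)).trans subset_closure
      _ ⊆ ⋃ n, C n := subset_iUnion C (i + 1)
  have hinf : ⨅ n, ρ x (C n) = 0 := by
    rw [← hρ.closure_iUnion_nat hC hmono,
      hρ.eq_zero_iff _ (isRegularlyClosed_closure_iUnion hC)]
    exact hxC
  obtain ⟨n, hn⟩ := exists_lt_of_ciInf_lt (hinf.trans_lt hε)
  refine ⟨max n (m + 1), lt_max_of_lt_right m.lt_succ_self, ?_⟩
  exact (hρ.anti _ _ (hC _) (hC _) (hmono (le_max_left _ _)) x).trans_lt hn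

theorem exists_pairwise_disjoint_forall_infinite_mem_closure (hρ : IsKappaMetric ρ)
    (hU : ∀ n, IsOpen (U n)) (hdisj : Pairwise (Disjoint on U))
    (hx : ∀ m, x ∈ closure (⋃ n ≥ m, U n)) :
    ∃ V : ℕ → Set X, (∀ k, IsOpen (V k)) ∧ Pairwise (Disjoint on V) ∧
      ∀ I : Set ℕ, I.Infinite → x ∈ closure (⋃ k ∈ I, V k) := by
  choose next hlt hnext using fun m : ℕ =>
    hρ.exists_lt_closure_biUnion_Ico hU (hx m) (Nat.one_div_pos_of_nat (α := ℝ≥0) (n := m))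
  let a (k : ℕ) : ℕ := next^[k] 0
  have ha_succ (k : ℕ) : a (k + 1) = next (a k) := Function.iterate_succ_apply' next k 0
  have ha : StrictMono a := strictMono_nat_of_lt_succ fun k => ha_succ k ▸ hlt (a k)
  let V (k : ℕ) : Set X := ⋃ i ∈ Ico (a k) (a (k + 1)), U i
  have hV (k : ℕ) : IsOpen (V k) := isOpen_biUnion fun i _ => hU i
  have hV_small (k : ℕ) : ρ x (closure (V k)) < 1 / ((k : ℝ≥0) + 1) := by
    calc ρ x (closure (V k)) < 1 / ((a k : ℝ≥0) + 1) := by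
          simpa only [V, ha_succ] using hnext (a k)
      _ ≤ 1 / ((k : ℝ≥0) + 1) := Nat.one_div_le_one_div ha.le_apply
  refine ⟨V, hV, fun k l hkl => disjoint_biUnion_of_pairwise_disjoint hdisj
    (ha.monotone.pairwise_disjoint_on_Ico_succ hkl), fun I hI => ?_⟩
  refine hρ.mem_of_forall_exists_lt
    (isRegularlyClosed_closure (isOpen_biUnion fun k _ => hV k)) fun ε hε => ?_
  obtain ⟨N, hN⟩ := exists_nat_one_div_lt hε
  obtain ⟨k, hkI, hNk⟩ := hI.exists_gt N
  refine ⟨closure (V k), closure_mono (subset_biUnion_of_mem (u := V) hkI),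
    isRegularlyClosed_closure (hV k), ?_⟩
  exact (hV_small k).trans ((Nat.one_div_le_one_div hNk.le).trans_lt hN)

end IsKappaMetric

end AccumulatingSequences

namespace KappaMetrizable

variable {X : Type u} [TopologicalSpace X]

theorem locallyFinite_of_pairwise_disjoint [ExtremallyDisconnected X] (hX : KappaMetrizable X)
    {U : ℕ → Set X} (hU : ∀ n, IsOpen (U n)) (hdisj : Pairwise (Disjoint on U)) :
    LocallyFinite U := by
  obtain ⟨ρ, hρ⟩ := hX
  by_contra hnot
  obtain ⟨x, hx⟩ := exists_forall_mem_closure_of_not_locallyFinite hnot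
  obtain ⟨V, hV, hVdisj, hxV⟩ :=
    hρ.exists_pairwise_disjoint_forall_infinite_mem_closure hU hdisj hx
  have hparity : Disjoint {n : ℕ | Even n} {n | Odd n} :=
    disjoint_left.2 fun _ he ho => Nat.not_even_iff_odd.2 ho he
  have hclosure : Disjoint (closure (⋃ k ∈ {n | Even n}, V k)) (closure (⋃ k ∈ {n | Odd n}, V k)) :=
    ExtremallyDisconnected.disjoint_closure_of_disjoint_isOpen
      (disjoint_biUnion_of_pairwise_disjoint hVdisj hparity)
      (isOpen_biUnion fun k _ => hV k) (isOpen_biUnion fun k _ => hV k)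
  exact disjoint_left.1 hclosure
    (hxV _ (Nat.frequently_atTop_iff_infinite.1 Nat.frequently_even))
    (hxV _ (Nat.frequently_atTop_iff_infinite.1 Nat.frequently_odd))

theorem finite_of_compactSpace [CompactSpace X] [T2Space X] [ExtremallyDisconnected X]
    (hX : KappaMetrizable X) : Finite X := by
  by_contra hfin
  have : Infinite X := not_finite_iff_infinite.1 hfin
  obtain ⟨U, hUinf, hU, hdisj⟩ := exists_seq_infinite_isOpen_pairwise_disjoint X
  have hUne : {n | (U n).Nonempty} = univ := eq_univ_of_forall fun n => (hUinf n).nonempty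
  exact infinite_univ
    (hUne ▸ (hX.locallyFinite_of_pairwise_disjoint hU hdisj).finite_nonempty_of_compact)

theorem quasiKappaMetrizable (hX : KappaMetrizable X) : QuasiKappaMetrizable X := by
  obtain ⟨ρ, hρ⟩ := hX
  refine ⟨ρ, hρ.toKappaCore, fun C hC =>
    ⟨Cᶜ, hC.isClosed.isOpen_compl, Subset.rfl, subset_closure, fun x => ?_⟩⟩
  rw [pos_iff_ne_zero, Ne, hρ.eq_zero_iff C hC, mem_compl_iff]

end KappaMetrizable

-- The truncation at `1` makes the distance to the empty set finite.
theorem isKappaMetric_min_one_infEDist (X : Type u) [PseudoEMetricSpace X] :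
    IsKappaMetric fun (x : X) C => (min 1 (Metric.infEDist x C)).toNNReal := by
  have hfin (x : X) (C : Set X) : min 1 (Metric.infEDist x C) ≠ ⊤ :=
    ne_top_of_le_ne_top ENNReal.one_ne_top (min_le_left _ _)
  refine ⟨⟨fun C C' _ _ hCC' x => ?_, fun C _ => ?_, fun ι _ _ _ C _ _ x => ?_⟩, fun C hC x => ?_⟩
  · exact ENNReal.toNNReal_mono (hfin x C) (min_le_min_left _ (Metric.infEDist_anti hCC'))
  · exact ENNReal.continuousOn_toNNReal.comp_continuous
      (continuous_const.min Metric.continuous_infEDist) (fun x => hfin x C)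
  · rw [Metric.infEDist_closure, Metric.infEDist_iUnion, inf_iInf,
      ENNReal.toNNReal_iInf fun i => hfin x (C i)]
  · rw [ENNReal.toNNReal_eq_zero_iff, or_iff_left (hfin x C), ← bot_eq_zero, min_eq_bot,
      or_iff_right (bot_eq_zero (α := ℝ≥0∞) ▸ one_ne_zero), bot_eq_zero,
      ← Metric.mem_closure_iff_infEDist_zero, hC.isClosed.closure_eq]

namespace IsAbsolute

variable {Z X : Type u} [TopologicalSpace Z] [TopologicalSpace X] {f : Z → X}

theorem quasiKappaMetrizable (hf : IsAbsolute f) (hX : QuasiKappaMetrizable X) :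
    QuasiKappaMetrizable Z :=
  let ⟨_, hρ⟩ := hX
  ⟨_, hρ.comap hf.isIrreducibleMap hf.perfect.isClosedMap hf.perfect.continuous⟩

theorem regularlyQuasiKappaMetrizable (hf : IsAbsolute f)
    (hX : RegularlyQuasiKappaMetrizable X) : RegularlyQuasiKappaMetrizable Z :=
  let ⟨_, hρ, hreg⟩ := hX
  ⟨_, hρ.comap hf.isIrreducibleMap hf.perfect.isClosedMap hf.perfect.continuous,
    hreg.comap hf.isIrreducibleMap hf.perfect.isClosedMap hf.perfect.continuous⟩

theorem not_kappaMetrizable [CompactSpace X] [Infinite X] (hf : IsAbsolute f) :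
    ¬ KappaMetrizable Z := by
  have := hf.tychonoff
  have := hf.extremallyDisconnected
  have : Infinite Z := Infinite.of_surjective f hf.surjective
  have : CompactSpace Z := ⟨hf.perfect.isCompact_preimage isCompact_univ⟩
  exact fun hZ => not_finite_iff_infinite.2 ‹Infinite Z› hZ.finite_of_compactSpace

end IsAbsolute

theorem exists_quasiKappaMetrizable_not_kappaMetrizable :
    ∃ (Z : Type u) (_ : TopologicalSpace Z), T35Space Z ∧
      QuasiKappaMetrizable Z ∧ ¬ KappaMetrizable Z := by
  have : Infinite unitInterval := (Icc_infinite zero_lt_one).to_subtype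
  obtain ⟨Z, _, f, hf⟩ := exists_isAbsolute (ULift.{u} unitInterval)
  have hI : KappaMetrizable (ULift.{u} unitInterval) := ⟨_, isKappaMetric_min_one_infEDist _⟩
  exact ⟨Z, _, hf.tychonoff, hf.quasiKappaMetrizable hI.quasiKappaMetrizable,
    hf.not_kappaMetrizable⟩

theorem corollary3p7_general :
    (∀ (X : Type u) [TopologicalSpace X] [T35Space X],
      ∃ (Z : Type u) (_ : TopologicalSpace Z) (f : Z → X), IsAbsolute f) ∧
    (∀ (X Z : Type u) [TopologicalSpace X] [TopologicalSpace Z] (f : Z → X), IsAbsolute f →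
      (QuasiKappaMetrizable X → QuasiKappaMetrizable Z) ∧
      (RegularlyQuasiKappaMetrizable X → RegularlyQuasiKappaMetrizable Z)) ∧
    (∀ (X Z : Type u) [TopologicalSpace X] [TopologicalSpace Z] [CompactSpace X] [Infinite X]
      (f : Z → X), IsAbsolute f → ¬ KappaMetrizable Z) ∧
    (∀ (X : Type u) [TopologicalSpace X], KappaMetrizable X → QuasiKappaMetrizable X) ∧
    (∃ (X : Type u) (_ : TopologicalSpace X), T35Space X ∧
      QuasiKappaMetrizable X ∧ ¬ KappaMetrizable X) :=
  ⟨fun X => exists_isAbsolute X,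
    fun _ _ _ _ _ hf => ⟨hf.quasiKappaMetrizable, hf.regularlyQuasiKappaMetrizable⟩,
    fun _ _ _ _ _ _ _ hf => hf.not_kappaMetrizable,
    fun _ _ hX => hX.quasiKappaMetrizable,
    exists_quasiKappaMetrizable_not_kappaMetrizable⟩

theorem corollary3p7 :
    -- every Tychonoff space has an absolute
    (∀ (X : Type u) [TopologicalSpace X] [T35Space X],
      ∃ (Z : Type u) (_ : TopologicalSpace Z) (f : Z → X), IsAbsolute f) ∧
    -- the absolute of a (regularly) quasi κ-metrizable space is (regularly) quasi κ-metrizable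
    (∀ (X Z : Type u) [TopologicalSpace X] [TopologicalSpace Z] [T35Space X] (f : Z → X),
      IsAbsolute f →
        (QuasiKappaMetrizable X → QuasiKappaMetrizable Z) ∧
        (RegularlyQuasiKappaMetrizable X → RegularlyQuasiKappaMetrizable Z)) ∧
    -- the absolute of an infinite κ-metrizable compactum is quasi κ-metrizable, not κ-metrizable
    (∀ (X Z : Type u) [TopologicalSpace X] [TopologicalSpace Z] [T35Space X] [CompactSpace X]
      [Infinite X] (f : Z → X), IsAbsolute f → KappaMetrizable X →
        QuasiKappaMetrizable Z ∧ ¬ KappaMetrizable Z) ∧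
    -- the κ-metrizable spaces form a proper subclass of the quasi κ-metrizable spaces
    (∀ (X : Type u) [TopologicalSpace X] [T35Space X],
      KappaMetrizable X → QuasiKappaMetrizable X) ∧
    (∃ (X : Type u) (_ : TopologicalSpace X), T35Space X ∧
      QuasiKappaMetrizable X ∧ ¬ KappaMetrizable X) := by
  obtain ⟨hexists, hquasi, hnot, hkappa, hproper⟩ := corollary3p7_general.{u}
  exact ⟨hexists, fun X Z _ _ _ => hquasi X Z, fun X Z _ _ _ _ _ f hf hX =>
    ⟨(hquasi X Z f hf).1 (hkappa X hX), hnot X Z f hf⟩, fun X _ _ => hkappa X, hproper⟩
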